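/- **Definitions.** Let $(G,+)$ be an abelian Polish group. A set $A\subseteq G$ is *Haar meager* if there are a Borel set $B\supseteq A$, a nonempty compact metric space $K$ and a continuous function $f:K\to G$ such that $f^{-1}(B+g)$ is meager in $K$ for every $g\in G$; such an $f$ is called a *witness function* for $A$. A set $A\subseteq G$ is *strongly Haar meager* if there are a Borel set $B\supseteq A$ and a nonempty compact set $C\subseteq G$ such that $(B+g)\cap C$ is meager in $C$ for every $g\in G$. For finite or infinite sequences, $^\frown$ denotes concatenation, $|s|$ is the length of a finite sequence $s$, and $\omega^{<\omega}$ is the set of finite sequences of nonnegative integers. A finite or infinite sequence is *$m$-segmented* if it is a concatenation of constant blocks of length $2^m$. Call a family $(b_s)_{s\in\omega^{<\omega}}$ of finite $0$-$1$ sequences a *binary system* if 1. $b_\emptyset=\emptyset$; 2. $2^{|s|}$ divides $|b_s|$ for every $s$; 3. if $\beta$ is a nonempty finite $|s|$-segmented $0$-$1$ sequence such that $2^{|s|+1}$ divides $|b_s|+|\beta|$, then there is exactly one $\ell\in\omega$ with $b_{s^\frown\ell}=b_s{}^\frown\beta$; 4. for all $s$ and $\ell\in\omega$, $b_{s^\frown\ell}=b_s{}^\frown\beta$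 for some $\beta$ as in 3. Given a binary system, let $$C_s=\{b_s{}^\frown x : x\in\{0,1\}^\omega \text{ is } |s|\text{-segmented}\}\subseteq\{0,1\}^\omega\subseteq\mathbb Z^\omega .$$ For $s=(s_0,\dots,s_{k-1})\in\omega^{<\omega}$ let $h_0(s)\in\{0,1\}^\omega$ be the sequence consisting of $s_0$ zeroes, a one, $s_1$ zeroes, a one, …, $s_{k-1}$ zeroes, a one, and then only zeroes. Let $K_0$ be the closure of $\bigcup_{s\in\omega^{<\omega}}C_s\times\{h_0(s)\}$ in $\mathbb Z^\omega\times\{0,1\}^\omega$, and let $f_0:K_0\to\mathbb Z^\omega$, $f_0(x,y)=x$. **Theorem.** Binary systems exist. For every binary system, with $K_0$ and $f_0$ defined from it as above, there is a $G_\delta$ set $R$ in the abelian Polish group $\mathbb Z^\omega$ such that - $R$ is Haar meager but not strongly Haar meager; - $f_0:K_0\to\mathbb Z^\omega$ is a witness function for $R$ (in particular, $K_0$ is a nonempty compact metrizable space); - for every nonempty compact set $K\subseteq\mathbb Z^\omega$ there is a $g\in\mathbb Z^\omega$ such that $(R+g)\cap K$ is comeager in $K$. Consequently, the answer to Darji's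 question is negative: it is not true that in every abelian Polish group every Haar meager set is strongly Haar meager. -/

import Mathlib

open Set Topology

/-- The translate `B + g` of a subset `B` of an abelian group. -/
def translateSet {G : Type*} [AddCommGroup G] (B : Set G) (g : G) : Set G :=
  (fun x => x + g) '' B

/-- `A` is meager in the subspace `C`, that is, `A ∩ C` is a meager subset of the space `C`. -/
def MeagerIn {X : Type*} [TopologicalSpace X] (A C : Set X) : Prop :=
  IsMeagre ((↑) ⁻¹' A : Set C)

/-- `A` is comeager in the subspace `C`, that is, the complement of `A ∩ C` in `C` is a meager
subset of the space `C`. -/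
def ComeagerIn {X : Type*} [TopologicalSpace X] (A C : Set X) : Prop :=
  IsMeagre (((↑) ⁻¹' A : Set C)ᶜ)

/-- `f : K → G` is a witness function for the set `A` in the abelian Polish group `G`: its domain
`K` is a nonempty compact metrizable space, `f` is continuous, and for some Borel set `B ⊇ A` all
the preimages `f ⁻¹ (B + g)` are meager in `K`. -/
structure IsWitnessFunction {G : Type*} [AddCommGroup G] [TopologicalSpace G]
    [IsTopologicalAddGroup G] [PolishSpace G] {K : Type*} [TopologicalSpace K]
    (f : K → G) (A : Set G) : Prop where
  nonempty : Nonempty K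
  compact : CompactSpace K
  metrizable : TopologicalSpace.MetrizableSpace K
  continuous : Continuous f
  exists_borel : ∃ B : Set G, @MeasurableSet G (borel G) B ∧ A ⊆ B ∧
    ∀ g : G, IsMeagre (f ⁻¹' translateSet B g)

/-- Haar meager sets in an abelian Polish group. (Every compact metrizable space is homeomorphic to
one in `Type`, so the universe of `K` is no restriction.) -/
def IsHaarMeager {G : Type*} [AddCommGroup G] [TopologicalSpace G]
    [IsTopologicalAddGroup G] [PolishSpace G] (A : Set G) : Prop :=
  ∃ (K : Type) (_ : TopologicalSpace K) (f : K → G), IsWitnessFunction f A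

/-- Strongly Haar meager sets in an abelian Polish group. -/
def IsStronglyHaarMeager {G : Type*} [AddCommGroup G] [TopologicalSpace G]
    [IsTopologicalAddGroup G] [PolishSpace G] (A : Set G) : Prop :=
  ∃ B : Set G, @MeasurableSet G (borel G) B ∧ A ⊆ B ∧
    ∃ C : Set G, C.Nonempty ∧ IsCompact C ∧ ∀ g : G, MeagerIn (translateSet B g) C

/-- The concatenation of a finite sequence and an infinite one. -/
def appendSeq {α : Type*} (l : List α) (x : ℕ → α) : ℕ → α :=
  fun n => if h : n < l.length then l[n] else x (n - l.length)

/-- An infinite sequence is `m`-segmented if it is the concatenation of constant blocks of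
length `2 ^ m`. -/
def IsSegmentedSeq {α : Type*} (m : ℕ) (x : ℕ → α) : Prop :=
  ∀ q r₁ r₂ : ℕ, r₁ < 2 ^ m → r₂ < 2 ^ m → x (q * 2 ^ m + r₁) = x (q * 2 ^ m + r₂)

/-- A finite sequence is `m`-segmented if it is the concatenation of constant blocks of
length `2 ^ m`. -/
def IsSegmentedList {α : Type*} (m : ℕ) (l : List α) : Prop :=
  ∃ Q : ℕ, l.length = Q * 2 ^ m ∧ ∀ q < Q, ∀ r₁ r₂ : ℕ, r₁ < 2 ^ m → r₂ < 2 ^ m →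
    l[q * 2 ^ m + r₁]? = l[q * 2 ^ m + r₂]?

/-- `β` is an admissible continuation of the finite binary sequence `c` at level `m`: it is
nonempty and `m`-segmented, and `|c| + |β|` is divisible by `2 ^ (m + 1)`. -/
def IsContinuation (m : ℕ) (c β : List (Fin 2)) : Prop :=
  β ≠ [] ∧ IsSegmentedList m β ∧ 2 ^ (m + 1) ∣ c.length + β.length

/-- The defining properties of a system of finite binary sequences `b s`, indexed by the finite
sequences `s` of natural numbers: `b ∅ = ∅`, and for each `s` the sequences `b (s ⌢ ℓ)`, `ℓ ∈ ω`,
enumerate without repetition all `b s ⌢ β` with `β` an admissible continuation. -/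
structure IsBinarySystem (b : List ℕ → List (Fin 2)) : Prop where
  nil : b [] = []
  dvd_length : ∀ s : List ℕ, 2 ^ s.length ∣ (b s).length
  existsUnique : ∀ (s : List ℕ) (β : List (Fin 2)), IsContinuation s.length (b s) β →
    ∃! l : ℕ, b (s ++ [l]) = b s ++ β
  exists_eq : ∀ (s : List ℕ) (l : ℕ), ∃ β : List (Fin 2),
    IsContinuation s.length (b s) β ∧ b (s ++ [l]) = b s ++ β

/-- The inclusion of `{0,1}^ω` in `ℤ^ω`. -/
def binaryToInt (x : ℕ → Fin 2) : ℕ → ℤ := fun n => ((x n : ℕ) : ℤ)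

/-- The set `C_s ⊆ {0,1}^ω ⊆ ℤ^ω` of all sequences `b s ⌢ x` with `x` an `|s|`-segmented
0-1 sequence. -/
def cSet (b : List ℕ → List (Fin 2)) (s : List ℕ) : Set (ℕ → ℤ) :=
  {y | ∃ x : ℕ → Fin 2, IsSegmentedSeq s.length x ∧ y = binaryToInt (appendSeq (b s) x)}

/-- The code `h(s)`: each entry `n` of `s` is replaced by `n` zeroes followed by a one. -/
def hCode (s : List ℕ) : List (Fin 2) :=
  s.flatMap fun n => List.replicate n 0 ++ [1]

/-- The code `h(s)` extended by zeroes to an infinite sequence. -/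
def hZero (s : List ℕ) : ℕ → Fin 2 := appendSeq (hCode s) fun _ => 0

/-- The set `K₀`, a subset of `ℤ^ω × {0,1}^ω` (both factors carry the product topology). -/
def kZero (b : List ℕ → List (Fin 2)) : Set ((ℕ → ℤ) × (ℕ → Fin 2)) :=
  closure (⋃ s : List ℕ, cSet b s ×ˢ {hZero s})

/-- The map `f₀ : K₀ → ℤ^ω`, the restriction of the projection to the first coordinate. -/
def fZero (b : List ℕ → List (Fin 2)) : kZero b → (ℕ → ℤ) := fun p => p.1.1

/-! A compact set contains only "few" points of the form `g + x`, where `x` has a block constant at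
level `m + 1` and the whole translate by `g` of the level `m` cylinder lies in the set. These points
form the thin parts: they are closed, countable in number, and nowhere dense in the compact set
(`exists_agree_notMem_thinPart`). Every compact `K` has a code `c : ℕ → ℕ`; `R` is the union, over
all codes `c`, of the coded set without its thin parts, translated by `codeShift c`. Undoing the
shift for a code of `K` leaves a comeager part of `K`.

The shifts are so sparse that `c` can be read continuously off each point of `R`, which makes `R` a
Gδ set, and that each translate of `R` meets the binary sequences in points of a single code. Hence
only one coded set matters for each preimage under `f₀`. If such a preimage were dense in a nonempty
open part of `K₀`, the corresponding translate of the coded set would contain a whole level `|s|`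
cylinder around `b (s ⌢ l)`. Then `C_{s ⌢ l}` lies in a translated thin part, and `K₀` has an open
piece whose first coordinates all lie in `C_{s ⌢ l}`, so that the preimage misses it
(`isNowhereDense_preimage_diff_thinPart`). The set `R` does not depend on the binary system. -/

/-! ### Concatenation and segmented sequences. -/

section Sequences

theorem appendSeq_append {α : Type*} (l₁ l₂ : List α) (x : ℕ → α) :
    appendSeq (l₁ ++ l₂) x = appendSeq l₁ (appendSeq l₂ x) := by
  funext n
  simp only [appendSeq, List.length_append]
  by_cases h₁ : n < l₁.length
  · simp [h₁, Nat.lt_add_right _ h₁]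
  · by_cases h₂ : n - l₁.length < l₂.length
    · have : n < l₁.length + l₂.length := by omega
      simp [h₁, h₂, this, List.getElem_append_right (Nat.le_of_not_lt h₁)]
    · have : ¬ n < l₁.length + l₂.length := by omega
      simp [h₁, h₂, this, Nat.sub_sub]

theorem appendSeq_of_lt {α : Type*} {l : List α} (x y : ℕ → α) {n : ℕ} (h : n < l.length) :
    appendSeq l x n = appendSeq l y n := by
  simp [appendSeq, h]

theorem appendSeq_length_add {α : Type*} (l : List α) (x : ℕ → α) (n : ℕ) :
    appendSeq l x (l.length + n) = x n := by
  simp [appendSeq]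

theorem appendSeq_eq_self {α : Type*} {l : List α} {x : ℕ → α}
    (h : ∀ (n : ℕ) (hn : n < l.length), x n = l[n]) :
    appendSeq l (fun n => x (l.length + n)) = x := by
  funext n
  unfold appendSeq
  by_cases hn : n < l.length
  · simp [hn, h n hn]
  · simp only [hn, dite_false]
    congr 1
    omega

theorem appendSeq_injective {α : Type*} (l : List α) : Function.Injective (appendSeq l) := by
  intro x y h
  funext n
  have := congrFun h (l.length + n)
  rwa [appendSeq_length_add, appendSeq_length_add] at this

theorem continuous_appendSeq {α : Type*} [TopologicalSpace α] (l : List α) :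
    Continuous (appendSeq l) := by
  refine continuous_pi fun n => ?_
  unfold appendSeq
  by_cases h : n < l.length
  · simpa [h] using continuous_const
  · simpa [h] using continuous_apply _

theorem continuous_binaryToInt : Continuous binaryToInt :=
  continuous_pi fun n =>
    (continuous_of_discreteTopology (f := fun i : Fin 2 => ((i : ℕ) : ℤ))).comp (continuous_apply n)

/-- A neighbourhood of a sequence contains all the sequences that agree with it for long enough. -/
theorem exists_prefix_subset {α : Type*} [TopologicalSpace α] [DiscreteTopology α]
    {U : Set (ℕ → α)} {x : ℕ → α} (hU : U ∈ 𝓝 x) :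
    ∃ n, ∀ y : ℕ → α, (∀ i < n, y i = x i) → y ∈ U := by
  obtain ⟨_, ⟨z, n, rfl⟩, hx, hzU⟩ :=
    (PiNat.isTopologicalBasis_cylinders fun _ : ℕ => α).mem_nhds_iff.1 hU
  refine ⟨n, fun y hy => hzU fun i hi => ?_⟩
  rw [hy i hi, hx i hi]

theorem isSegmentedSeq_iff_of_dvd {α : Type*} {m : ℕ} {x : ℕ → α} :
    IsSegmentedSeq m x ↔ ∀ n k, n / 2 ^ m = k / 2 ^ m → x n = x k := by
  have hpos : 0 < 2 ^ m := by positivity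
  constructor
  · intro h n k hnk
    have := h (n / 2 ^ m) (n % 2 ^ m) (k % 2 ^ m) (Nat.mod_lt _ hpos) (Nat.mod_lt _ hpos)
    rwa [Nat.div_add_mod', hnk, Nat.div_add_mod'] at this
  · intro h q r₁ r₂ h₁ h₂
    apply h
    rw [mul_comm, Nat.mul_add_div hpos, Nat.mul_add_div hpos, Nat.div_eq_of_lt h₁,
      Nat.div_eq_of_lt h₂]

theorem IsSegmentedSeq.of_succ {α : Type*} {m : ℕ} {x : ℕ → α} (h : IsSegmentedSeq (m + 1) x) :
    IsSegmentedSeq m x := by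
  rw [isSegmentedSeq_iff_of_dvd] at h ⊢
  intro n k hnk
  apply h
  rw [pow_succ, ← Nat.div_div_eq_div_mul, ← Nat.div_div_eq_div_mul, hnk]

theorem IsSegmentedSeq.appendSeq {α : Type*} {m : ℕ} {l : List α} {x : ℕ → α}
    (hl : IsSegmentedList m l) (hx : IsSegmentedSeq m x) : IsSegmentedSeq m (appendSeq l x) := by
  obtain ⟨Q, hQ, hl⟩ := hl
  intro q r₁ r₂ h₁ h₂
  unfold _root_.appendSeq
  by_cases hq : q < Q
  · have hle : (q + 1) * 2 ^ m ≤ Q * 2 ^ m := Nat.mul_le_mul_right _ hq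
    have e₁ : q * 2 ^ m + r₁ < l.length := by rw [hQ]; linarith
    have e₂ : q * 2 ^ m + r₂ < l.length := by rw [hQ]; linarith
    have := hl q hq r₁ r₂ h₁ h₂
    rw [List.getElem?_eq_getElem e₁, List.getElem?_eq_getElem e₂] at this
    simpa [e₁, e₂] using this
  · obtain ⟨t, rfl⟩ := Nat.exists_eq_add_of_le (Nat.le_of_not_lt hq)
    have e : ∀ r, (Q + t) * 2 ^ m + r = l.length + (t * 2 ^ m + r) := by
      intro r; rw [hQ]; ring
    simpa [e] using hx t r₁ r₂ h₁ h₂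

end Sequences

/-! ### Segmented cylinders, and thin parts of compact sets. -/

section Cylinders

/-- The set of all sequences `β ⌢ x` with `x` an `m`-segmented 0-1 sequence. -/
def segmentedCylinder (β : List (Fin 2)) (m : ℕ) : Set (ℕ → ℤ) :=
  {y | ∃ x : ℕ → Fin 2, IsSegmentedSeq m x ∧ y = binaryToInt (appendSeq β x)}

theorem isCompact_segmentedCylinder (β : List (Fin 2)) (m : ℕ) :
    IsCompact (segmentedCylinder β m) := by
  have hcl : IsClosed {x : ℕ → Fin 2 | IsSegmentedSeq m x} := by
    simp only [IsSegmentedSeq, ofPred_forall]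
    exact isClosed_iInter fun q => isClosed_iInter fun r₁ => isClosed_iInter fun r₂ =>
      isClosed_iInter fun _ => isClosed_iInter fun _ =>
        isClosed_eq (continuous_apply _) (continuous_apply _)
  have himage : segmentedCylinder β m =
      (fun x => binaryToInt (appendSeq β x)) '' {x : ℕ → Fin 2 | IsSegmentedSeq m x} := by
    ext y
    simp only [segmentedCylinder, mem_ofPred_eq, mem_image, eq_comm]
  rw [himage]
  exact hcl.isCompact.image (continuous_binaryToInt.comp (continuous_appendSeq β))

theorem segmentedCylinder_succ_subset (β : List (Fin 2)) (m : ℕ) :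
    segmentedCylinder β (m + 1) ⊆ segmentedCylinder β m := by
  rintro _ ⟨x, hx, rfl⟩
  exact ⟨x, hx.of_succ, rfl⟩

theorem segmentedCylinder_append_subset (c : List (Fin 2)) {β : List (Fin 2)} {m : ℕ}
    (hβ : IsSegmentedList m β) : segmentedCylinder (c ++ β) m ⊆ segmentedCylinder c m := by
  rintro _ ⟨x, hx, rfl⟩
  exact ⟨appendSeq β x, hx.appendSeq hβ, by rw [appendSeq_append]⟩

theorem segmentedCylinder_nonempty (β : List (Fin 2)) (m : ℕ) :
    (segmentedCylinder β m).Nonempty :=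
  ⟨_, fun _ => 0, fun _ _ _ _ _ => rfl, rfl⟩

/-- The points of `g + segmentedCylinder β (m + 1)`, where `g` ranges over the elements with
`g + segmentedCylinder β m ⊆ K`. -/
def thinPart (K : Set (ℕ → ℤ)) (β : List (Fin 2)) (m : ℕ) : Set (ℕ → ℤ) :=
  {z | ∃ x ∈ segmentedCylinder β (m + 1), ∀ w ∈ segmentedCylinder β m, z - x + w ∈ K}

theorem binaryToInt_nonneg (x : ℕ → Fin 2) (n : ℕ) : 0 ≤ binaryToInt x n := by
  simp [binaryToInt]

theorem binaryToInt_le_one (x : ℕ → Fin 2) (n : ℕ) : binaryToInt x n ≤ 1 := by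
  have := (x n).isLt
  simp only [binaryToInt]
  omega

/-- Every coordinate is bounded on a compact set of integer sequences. -/
theorem exists_coord_bound {K : Set (ℕ → ℤ)} (hK : IsCompact K) :
    ∃ M : ℕ → ℕ, ∀ k ∈ K, ∀ n, |k n| ≤ (M n : ℤ) := by
  have : ∀ n, ∃ M : ℕ, ∀ k ∈ K, |k n| ≤ (M : ℤ) := by
    intro n
    have hc : ContinuousOn (fun k : ℕ → ℤ => |k n|) K :=
      ((continuous_of_discreteTopology (f := fun i : ℤ => |i|)).comp
        (continuous_apply n)).continuousOn
    obtain ⟨M, hM⟩ := hK.bddAbove_image hc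
    refine ⟨M.toNat, fun k hk => (hM (mem_image_of_mem _ hk)).trans (Int.self_le_toNat M)⟩
  choose M hM using this
  exact ⟨M, fun k hk n => hM n k hk⟩

/-- Inside a compact set, the points of the thin part can be approximated by points outside it. -/
theorem exists_agree_notMem_thinPart {K : Set (ℕ → ℤ)} (hK : IsCompact K) {β : List (Fin 2)}
    {m : ℕ} {z₀ : ℕ → ℤ} (hz₀ : z₀ ∈ thinPart K β m) (n : ℕ) :
    ∃ z ∈ K, (∀ i < n, z i = z₀ i) ∧ z ∉ thinPart K β m := by
  obtain ⟨M, hM⟩ := exists_coord_bound hK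
  have hpos : 0 < 2 ^ m := by positivity
  -- After `β`, the positions `i` and `j` start the two halves of one block of length `2 ^ (m + 1)`.
  -- An element of the level `m + 1` cylinder takes equal values there, while one of level `m` need
  -- not. The `n` blocks skipped ensure `n ≤ i`, so changes from `i` on keep the agreement with
  -- `z₀`.
  set i := β.length + n * 2 ^ (m + 1) with hi
  set j := β.length + (n * 2 ^ (m + 1) + 2 ^ m) with hj
  have hni : n ≤ i := by
    have : n * 1 ≤ n * 2 ^ (m + 1) := Nat.mul_le_mul_left _ Nat.one_le_two_pow
    omega
  let P : ℤ → Prop := fun d => ∃ x ∈ segmentedCylinder β (m + 1), ∃ g : ℕ → ℤ,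
    (∀ w ∈ segmentedCylinder β m, g + w ∈ K) ∧ (∀ t < n, g t + x t = z₀ t) ∧ d = g i - g j
  have hbdd : ∀ d, P d → d ≤ M i + M j + 1 := by
    rintro d ⟨x, ⟨u, hu, rfl⟩, g, hg, -, rfl⟩
    have hgK := hg _ (segmentedCylinder_succ_subset β m ⟨u, hu, rfl⟩)
    have h₁ := abs_le.1 (hM _ hgK i)
    have h₂ := abs_le.1 (hM _ hgK j)
    have h₃ := binaryToInt_nonneg (appendSeq β u) i
    have h₄ := binaryToInt_le_one (appendSeq β u) j
    simp only [Pi.add_apply] at h₁ h₂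
    linarith [h₁.2, h₂.1]
  have hne : ∃ d, P d := by
    obtain ⟨x, hx, hxK⟩ := hz₀
    exact ⟨_, x, hx, z₀ - x, hxK, fun t _ => by simp, rfl⟩
  -- Extremal choice: `g i - g j` is as large as possible among the representations of thin points
  -- agreeing with `z₀` below `n`.
  obtain ⟨d, ⟨_, ⟨u, hu, rfl⟩, g, hg, hgz, rfl⟩, hmax⟩ :=
    Int.exists_greatest_of_bdd ⟨_, hbdd⟩ hne
  let v : ℕ → Fin 2 := fun t =>
    if t < n * 2 ^ (m + 1) then u t else if t < n * 2 ^ (m + 1) + 2 ^ m then 1 else 0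
  have hv : IsSegmentedSeq m v := by
    have hu' := hu.of_succ
    intro q r₁ r₂ h₁ h₂
    have key : ∀ a r, r < 2 ^ m → (q * 2 ^ m + r < a * 2 ^ m ↔ q < a) := by
      intro a r hr
      constructor
      · intro h
        by_contra! hqa
        have := Nat.mul_le_mul_right (2 ^ m) hqa
        omega
      · intro h
        have := Nat.mul_le_mul_right (2 ^ m) (Nat.succ_le_of_lt h)
        rw [Nat.succ_mul] at this
        omega
    have e₁ : n * 2 ^ (m + 1) = (2 * n) * 2 ^ m := by ring
    have e₂ : n * 2 ^ (m + 1) + 2 ^ m = (2 * n + 1) * 2 ^ m := by ring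
    simp only [v, e₂]
    simp only [e₁, key _ r₁ h₁, key _ r₂ h₂, hu' q r₁ r₂ h₁ h₂]
  have hvi : binaryToInt (appendSeq β v) i = 1 := by
    simp [binaryToInt, hi, appendSeq_length_add, v]
  have hvj : binaryToInt (appendSeq β v) j = 0 := by
    simp [binaryToInt, hj, appendSeq_length_add, v]
  have hvu : ∀ t < i, binaryToInt (appendSeq β v) t = binaryToInt (appendSeq β u) t := by
    intro t ht
    simp only [binaryToInt]
    by_cases h : t < β.length
    · rw [appendSeq_of_lt v u h]
    · obtain ⟨t', rfl⟩ := Nat.exists_eq_add_of_le (Nat.le_of_not_lt h)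
      rw [appendSeq_length_add, appendSeq_length_add]
      have : t' < n * 2 ^ (m + 1) := by omega
      simp [v, this]
  have hagree : ∀ t < n, (g + binaryToInt (appendSeq β v)) t = z₀ t := by
    intro t ht
    rw [Pi.add_apply, hvu t (ht.trans_le hni), hgz t ht]
  refine ⟨g + binaryToInt (appendSeq β v), hg _ ⟨v, hv, rfl⟩, hagree, ?_⟩
  -- If the new point were thin, subtracting a sequence with equal values at `i` and `j` would give
  -- a translation whose difference is `g i - g j + 1`, against maximality.
  rintro ⟨_, ⟨u', hu', rfl⟩, hK'⟩
  have hle := hmax _ ⟨_, ⟨u', hu', rfl⟩, _, hK', fun t ht => by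
    rw [Pi.sub_apply, sub_add_cancel, hagree t ht], rfl⟩
  have hseg : u' (n * 2 ^ (m + 1)) = u' (n * 2 ^ (m + 1) + 2 ^ m) := by
    have := hu' n 0 (2 ^ m) (by positivity) (by rw [pow_succ]; omega)
    simpa using this
  have heq : binaryToInt (appendSeq β u') i = binaryToInt (appendSeq β u') j := by
    simp only [binaryToInt, hi, hj, appendSeq_length_add, hseg]
  simp only [Pi.sub_apply, Pi.add_apply, hvi, hvj, heq] at hle
  linarith

end Cylinders

/-! ### Codes of compact sets, and the construction of the Gδ set. -/

section CodedSets

/-- The compact set coded by `c : ℕ → ℕ` relative to a sequence of open sets: `c` bounds the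
coordinates, and the parity of `c n` tells whether `V n` is to be removed. -/
def codedSet (V : ℕ → Set (ℕ → ℤ)) (c : ℕ → ℕ) : Set (ℕ → ℤ) :=
  {k | ∀ n, |k n| ≤ (c n : ℤ) ∧ (Even (c n) → k ∉ V n)}

/-- Closedness is needed jointly in point and code, since the code will vary continuously with the
point. -/
theorem isClosed_mem_codedSet {V : ℕ → Set (ℕ → ℤ)} (hV : ∀ n, IsOpen (V n)) :
    IsClosed {q : (ℕ → ℤ) × (ℕ → ℕ) | q.1 ∈ codedSet V q.2} := by
  simp only [codedSet, mem_ofPred_eq]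
  rw [ofPred_forall]
  refine isClosed_iInter fun n => IsClosed.inter (s₁ := {q : (ℕ → ℤ) × (ℕ → ℕ) | |q.1 n| ≤ (q.2 n : ℤ)})
    (s₂ := {q : (ℕ → ℤ) × (ℕ → ℕ) | Even (q.2 n) → q.1 ∉ V n}) ?_ ?_
  · have hc : Continuous fun q : (ℕ → ℤ) × (ℕ → ℕ) => (q.1 n, q.2 n) := by fun_prop
    exact (isClosed_discrete {r : ℤ × ℕ | |r.1| ≤ (r.2 : ℤ)}).preimage hc
  · refine isClosed_imp ?_ ?_
    · have hc : Continuous fun q : (ℕ → ℤ) × (ℕ → ℕ) => q.2 n := by fun_prop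
      exact (isOpen_discrete {r : ℕ | Even r}).preimage hc
    · exact ((hV n).preimage continuous_fst).isClosed_compl

theorem exists_codedSet_eq {V : ℕ → Set (ℕ → ℤ)}
    (hV : TopologicalSpace.IsTopologicalBasis (range V)) {K : Set (ℕ → ℤ)} (hK : IsCompact K) :
    ∃ c, codedSet V c = K := by
  classical
  obtain ⟨M, hM⟩ := exists_coord_bound hK
  -- Enlarging the bounds is harmless, which frees the parity to record the basic open sets that
  -- miss `K`.
  refine ⟨fun n => if Disjoint K (V n) then 2 * M n else 2 * M n + 1, ?_⟩
  ext k
  constructor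
  · intro hk
    by_contra hkK
    obtain ⟨_, ⟨n, rfl⟩, hkn, hnK⟩ := hV.exists_subset_of_mem_open
      (show k ∈ Kᶜ from hkK) hK.isClosed.isOpen_compl
    have hd : Disjoint K (V n) := disjoint_compl_right.mono_right hnK
    exact (hk n).2 (by simp [hd]) hkn
  · intro hk n
    refine ⟨(hM k hk n).trans ?_, fun he => ?_⟩
    · dsimp only
      split_ifs <;> push_cast <;> omega
    · by_cases hd : Disjoint K (V n)
      · exact disjoint_left.1 hd hk
      · simp [hd] at he

/-- The intervals `[3 a ^ 2 - a, 3 a ^ 2 + a]` are at distance at least two from each other. -/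
theorem interval_index_unique {a b : ℕ} {u v : ℤ} (hu : |u - 3 * (a : ℤ) ^ 2| ≤ (a : ℤ))
    (hv : |v - 3 * (b : ℤ) ^ 2| ≤ (b : ℤ)) (huv : |u - v| ≤ 1) : a = b := by
  rw [abs_le] at hu hv huv
  by_contra hab
  rcases lt_or_gt_of_ne hab with h | h
  -- The gap between the intervals of index `a` and `a + 1` is `4 * a + 2`, hence more than one.
  · have : (a : ℤ) + 1 ≤ b := by exact_mod_cast h
    nlinarith [Int.natCast_nonneg a]
  · have : (b : ℤ) + 1 ≤ a := by exact_mod_cast h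
    nlinarith [Int.natCast_nonneg b]

open Classical in
/-- The number `a` with `|u - 3 * a ^ 2| ≤ a`, if there is one. -/
noncomputable def intervalIndex (u : ℤ) : ℕ :=
  -- The default adds no points to `shiftedUnion`: with index `0` the coordinate bound forces `u =
  -- 0`, which does lie in the interval of index `0`.
  if h : ∃ a : ℕ, |u - 3 * a ^ 2| ≤ (a : ℤ) then h.choose else 0

theorem intervalIndex_eq {a : ℕ} {u : ℤ} (h : |u - 3 * a ^ 2| ≤ (a : ℤ)) :
    intervalIndex u = a := by
  have hex : ∃ a : ℕ, |u - 3 * a ^ 2| ≤ (a : ℤ) := ⟨a, h⟩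
  rw [intervalIndex, dif_pos hex]
  exact interval_index_unique hex.choose_spec h (by simp)

/-- The sequence of squares that is added to the elements of the set coded by `c`. -/
def codeShift (c : ℕ → ℕ) : ℕ → ℤ := fun n => 3 * (c n : ℤ) ^ 2

/-- The code read off from a shifted sequence. -/
noncomputable def decodeIndex (z : ℕ → ℤ) : ℕ → ℕ := fun n => intervalIndex (z n)

/-- The original sequence recovered from a shifted one. -/
noncomputable def decodeSeq (z : ℕ → ℤ) : ℕ → ℤ := z - codeShift (decodeIndex z)

theorem continuous_decodeIndex : Continuous decodeIndex :=
  continuous_pi fun n => (continuous_of_discreteTopology (f := intervalIndex)).comp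
    (continuous_apply n)

theorem continuous_decodeSeq : Continuous decodeSeq :=
  continuous_pi fun n => (continuous_of_discreteTopology
    (f := fun u : ℤ => u - 3 * (intervalIndex u : ℤ) ^ 2)).comp (continuous_apply n)

theorem decodeIndex_add {V : ℕ → Set (ℕ → ℤ)} {c : ℕ → ℕ} {k : ℕ → ℤ} (hk : k ∈ codedSet V c) :
    decodeIndex (k + codeShift c) = c := by
  funext n
  exact intervalIndex_eq (by simpa [codeShift] using (hk n).1)

theorem decodeSeq_add {V : ℕ → Set (ℕ → ℤ)} {c : ℕ → ℕ} {k : ℕ → ℤ} (hk : k ∈ codedSet V c) :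
    decodeSeq (k + codeShift c) = k := by
  rw [decodeSeq, decodeIndex_add hk, add_sub_cancel_right]

/-- The set of all `k + codeShift c` with `k` in the set coded by `c` but in none of its thin
parts. -/
def shiftedUnion (V : ℕ → Set (ℕ → ℤ)) : Set (ℕ → ℤ) :=
  {z | decodeSeq z ∈ codedSet V (decodeIndex z) ∧
    ∀ β m, decodeSeq z ∉ thinPart (codedSet V (decodeIndex z)) β m}

/-- The witness `x` in `thinPart` ranges over a compact cylinder, and projection along a compact
factor is a closed map. -/
theorem isClosed_decodeSeq_mem_thinPart {V : ℕ → Set (ℕ → ℤ)} (hV : ∀ n, IsOpen (V n))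
    (β : List (Fin 2)) (m : ℕ) :
    IsClosed {z | decodeSeq z ∈ thinPart (codedSet V (decodeIndex z)) β m} := by
  have : CompactSpace (segmentedCylinder β (m + 1)) :=
    isCompact_iff_compactSpace.1 (isCompact_segmentedCylinder β (m + 1))
  have hcl : IsClosed {q : (ℕ → ℤ) × segmentedCylinder β (m + 1) |
      ∀ w ∈ segmentedCylinder β m, decodeSeq q.1 - q.2 + w ∈ codedSet V (decodeIndex q.1)} := by
    simp only [ofPred_forall]
    refine isClosed_iInter fun w => isClosed_iInter fun _ => ?_
    have hc : Continuous fun q : (ℕ → ℤ) × segmentedCylinder β (m + 1) =>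
        (decodeSeq q.1 - (q.2 : ℕ → ℤ) + w, decodeIndex q.1) :=
      (((continuous_decodeSeq.comp continuous_fst).sub
        (continuous_subtype_val.comp continuous_snd)).add continuous_const).prodMk
        (continuous_decodeIndex.comp continuous_fst)
    exact (isClosed_mem_codedSet hV).preimage hc
  convert isClosedMap_fst_of_compactSpace _ hcl using 1
  ext z
  simp [thinPart]

theorem isGδ_shiftedUnion {V : ℕ → Set (ℕ → ℤ)} (hV : ∀ n, IsOpen (V n)) :
    IsGδ (shiftedUnion V) := by
  have hset : shiftedUnion V = {z | decodeSeq z ∈ codedSet V (decodeIndex z)} ∩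
      ⋂ (β : List (Fin 2)) (m : ℕ),
        {z | decodeSeq z ∈ thinPart (codedSet V (decodeIndex z)) β m}ᶜ := by
    ext z
    simp [shiftedUnion]
  rw [hset]
  refine IsGδ.inter ?_ (.iInter fun β => .iInter fun m =>
    (isClosed_decodeSeq_mem_thinPart hV β m).isOpen_compl.isGδ)
  exact ((isClosed_mem_codedSet hV).preimage
    (continuous_decodeSeq.prodMk continuous_decodeIndex)).isGδ

theorem exists_comeagerIn_translate {V : ℕ → Set (ℕ → ℤ)}
    (hV : TopologicalSpace.IsTopologicalBasis (range V)) {K : Set (ℕ → ℤ)} (hK : IsCompact K) :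
    ∃ g, ComeagerIn (translateSet (shiftedUnion V) g) K := by
  obtain ⟨c, rfl⟩ := exists_codedSet_eq hV hK
  refine ⟨-codeShift c, ?_⟩
  -- On `codedSet V c` decoding inverts the shift, so only the countably many thin parts are lost.
  have hsub : (((↑) ⁻¹' translateSet (shiftedUnion V) (-codeShift c) : Set (codedSet V c))ᶜ) ⊆
      ⋃ (β : List (Fin 2)) (m : ℕ), (↑) ⁻¹' thinPart (codedSet V c) β m := by
    intro k hk
    by_contra hcon
    simp only [mem_iUnion, mem_preimage, not_exists] at hcon
    refine hk ⟨k + codeShift c, ?_, by simp⟩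
    simpa only [shiftedUnion, mem_ofPred_eq, decodeSeq_add k.2, decodeIndex_add k.2] using
      ⟨k.2, hcon⟩
  refine IsMeagre.mono hsub ?_
  refine isMeagre_iUnion fun β => isMeagre_iUnion fun m => ?_
  have hclosed : IsClosed ((↑) ⁻¹' thinPart (codedSet V c) β m : Set (codedSet V c)) := by
    have hc : Continuous fun k : codedSet V c => (k : ℕ → ℤ) + codeShift c := by fun_prop
    convert (isClosed_decodeSeq_mem_thinPart
      (fun n => hV.isOpen (mem_range_self n)) β m).preimage hc using 1
    ext k
    simp [decodeSeq_add k.2, decodeIndex_add k.2]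
  refine IsNowhereDense.isMeagre (hclosed.isNowhereDense_iff.2 (eq_empty_of_forall_notMem ?_))
  intro k hk
  obtain ⟨W, hW, hWk⟩ := mem_nhds_subtype _ _ _ |>.1 (mem_interior_iff_mem_nhds.1 hk)
  obtain ⟨n, hn⟩ := exists_prefix_subset hW
  obtain ⟨z, hzK, hz, hzN⟩ :=
    exists_agree_notMem_thinPart hK (mem_preimage.1 (interior_subset hk)) n
  exact hzN (hWk (show (⟨z, hzK⟩ : codedSet V c) ∈ (↑) ⁻¹' W from hn z hz))

end CodedSets

/-! ### Existence of binary systems, and their extension properties. -/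

section BinarySystem

theorem appendSeq_congr_of_lt {α : Type*} (l : List α) {x y : ℕ → α} {n : ℕ}
    (h : ∀ t < n, x t = y t) : ∀ i < n, appendSeq l x i = appendSeq l y i := by
  intro i hi
  unfold appendSeq
  split_ifs with hl
  · rfl
  · exact h _ (by omega)

theorem appendSeq_map_range {α : Type*} (u v : ℕ → α) {N t : ℕ} (ht : t < N) :
    appendSeq ((List.range N).map u) v t = u t := by
  simp [appendSeq, ht]

/-- Adding `A + 2 * (j + 1)` blocks to the `A` blocks of `c` gives an even total, and a positive
number of them is added. Varying `j` gives infinitely many admissible prefixes of `u`. -/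
theorem isContinuation_map_range {m A : ℕ} {c : List (Fin 2)} (hc : c.length = A * 2 ^ m)
    {u : ℕ → Fin 2} (hu : IsSegmentedSeq m u) (j : ℕ) :
    IsContinuation m c ((List.range ((A + 2 * (j + 1)) * 2 ^ m)).map u) := by
  have hpos : 0 < 2 ^ m := by positivity
  refine ⟨?_, ⟨A + 2 * (j + 1), by simp, fun q hq r₁ r₂ h₁ h₂ => ?_⟩, ?_⟩
  · rw [← List.length_pos_iff]
    simp
  · have hle := Nat.mul_le_mul_right (2 ^ m) (Nat.succ_le_of_lt hq)
    rw [Nat.succ_mul] at hle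
    have e₁ : q * 2 ^ m + r₁ < (A + 2 * (j + 1)) * 2 ^ m := by omega
    have e₂ : q * 2 ^ m + r₂ < (A + 2 * (j + 1)) * 2 ^ m := by omega
    simp [e₁, e₂, hu q r₁ r₂ h₁ h₂]
  · rw [hc, List.length_map, List.length_range]
    exact ⟨A + j + 1, by ring⟩

theorem map_range_block_injective {A m : ℕ} (u : ℕ → Fin 2) :
    Function.Injective fun j => (List.range ((A + 2 * (j + 1)) * 2 ^ m)).map u := by
  intro j k hjk
  have := congrArg List.length hjk
  simp only [List.length_map, List.length_range] at this
  have := Nat.eq_of_mul_eq_mul_right (by positivity) this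
  omega

theorem infinite_continuations {m : ℕ} {c : List (Fin 2)} (hc : 2 ^ m ∣ c.length) :
    Infinite {β // IsContinuation m c β} := by
  obtain ⟨A, hA⟩ := hc
  rw [mul_comm] at hA
  refine Infinite.of_injective
    (fun j => ⟨_, isContinuation_map_range hA (u := fun _ => 0) (fun _ _ _ _ _ => rfl) j⟩) ?_
  intro j k hjk
  exact map_range_block_injective (fun _ => 0) (congrArg Subtype.val hjk)

open Classical in
/-- An enumeration of the admissible continuations of `c` at level `m`. -/
noncomputable def continuationEnum (m : ℕ) (c : List (Fin 2)) : ℕ → List (Fin 2) :=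
  if h : Nonempty (ℕ ≃ {β // IsContinuation m c β}) then fun l => (h.some l).1 else fun _ => []

theorem exists_equiv_continuationEnum {m : ℕ} {c : List (Fin 2)} (hc : 2 ^ m ∣ c.length) :
    ∃ e : ℕ ≃ {β // IsContinuation m c β}, ∀ l, continuationEnum m c l = e l := by
  have := infinite_continuations hc
  have h : Nonempty (ℕ ≃ {β // IsContinuation m c β}) := nonempty_equiv_of_countable
  exact ⟨h.some, fun l => by rw [continuationEnum, dif_pos h]⟩

/-- The recursion producing a binary system, together with the current level. -/
noncomputable def binarySystemAux (s : List ℕ) : ℕ × List (Fin 2) :=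
  s.foldl (fun q l => (q.1 + 1, q.2 ++ continuationEnum q.1 q.2 l)) (0, [])

theorem binarySystemAux_fst (s : List ℕ) : (binarySystemAux s).1 = s.length := by
  induction s using List.reverseRecOn with
  | nil => rfl
  | append_singleton s l ih =>
    rw [binarySystemAux, List.foldl_append]
    simpa [binarySystemAux] using ih

theorem binarySystemAux_snd_append (s : List ℕ) (l : ℕ) :
    (binarySystemAux (s ++ [l])).2 =
      (binarySystemAux s).2 ++ continuationEnum s.length (binarySystemAux s).2 l := by
  rw [← binarySystemAux_fst, binarySystemAux, List.foldl_append]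
  rfl

theorem exists_isBinarySystem : ∃ b, IsBinarySystem b := by
  have hdvd : ∀ s : List ℕ, 2 ^ s.length ∣ (binarySystemAux s).2.length := by
    intro s
    induction s using List.reverseRecOn with
    | nil => exact one_dvd _
    | append_singleton s l ih =>
      obtain ⟨e, he⟩ := exists_equiv_continuationEnum ih
      rw [binarySystemAux_snd_append, he, List.length_append, List.length_append]
      exact (e l).2.2.2
  refine ⟨fun s => (binarySystemAux s).2, rfl, hdvd, fun s β hβ => ?_, fun s l => ?_⟩
  · obtain ⟨e, he⟩ := exists_equiv_continuationEnum (hdvd s)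
    refine ⟨e.symm ⟨β, hβ⟩, ?_, fun l hl => ?_⟩
    · simp [binarySystemAux_snd_append, he]
    · dsimp only at hl
      rw [binarySystemAux_snd_append, he] at hl
      rw [Equiv.eq_symm_apply]
      exact Subtype.ext (List.append_cancel_left hl)
  · obtain ⟨e, he⟩ := exists_equiv_continuationEnum (hdvd s)
    exact ⟨e l, (e l).2, by rw [binarySystemAux_snd_append, he]⟩

variable {b : List ℕ → List (Fin 2)}

/-- Each step appends a `β` segmented at the current level and then imposes a stronger segmentation
on the tail. -/
theorem cSet_append_subset (hb : IsBinarySystem b) (s t : List ℕ) :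
    cSet b (s ++ t) ⊆ cSet b s := by
  induction t using List.reverseRecOn with
  | nil => simp
  | append_singleton t l ih =>
    refine Subset.trans ?_ ih
    obtain ⟨β, hβ, hbl⟩ := hb.exists_eq (s ++ t) l
    rw [← List.append_assoc]
    change segmentedCylinder (b _) (List.length _) ⊆ segmentedCylinder _ _
    rw [hbl, List.length_append, List.length_singleton]
    exact (segmentedCylinder_succ_subset _ _).trans (segmentedCylinder_append_subset _ hβ.2.1)

/-- Every `|s|`-segmented continuation of `b s` is approximated by `b (s ⌢ l)` with `l` large. -/
theorem IsBinarySystem.exists_large_extension (hb : IsBinarySystem b) (s : List ℕ)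
    {u : ℕ → Fin 2} (hu : IsSegmentedSeq s.length u) (n : ℕ) :
    ∃ l ≥ n, ∃ N ≥ n, IsSegmentedList s.length ((List.range N).map u) ∧
      b (s ++ [l]) = b s ++ (List.range N).map u := by
  obtain ⟨A, hA⟩ := hb.dvd_length s
  rw [mul_comm] at hA
  have hcont := isContinuation_map_range hA hu
  choose l hl using fun j => (hb.existsUnique s _ (hcont j)).exists
  have hinj : Function.Injective l := by
    intro j k hjk
    refine map_range_block_injective u (List.append_cancel_left ((hl j).symm.trans ?_))
    rw [hjk, hl k]
  -- Longer prefixes of `u` have distinct indices, so the indices tend to infinity. A large index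
  -- makes `hZero (s ++ [l])` close to `hZero s`.
  obtain ⟨j, hjl, hjn⟩ := ((hinj.nat_tendsto_atTop.eventually_ge_atTop n).and
    (Filter.eventually_ge_atTop n)).exists
  refine ⟨l j, hjl, _, ?_, (hcont j).2.1, hl j⟩
  have : (A + 2 * (j + 1)) * 1 ≤ (A + 2 * (j + 1)) * 2 ^ s.length :=
    Nat.mul_le_mul_left _ Nat.one_le_two_pow
  omega

end BinarySystem

/-! ### Prefix property and convergence of the codes `h(s)`. -/

section Codes

theorem appendSeq_block_apply_of_lt {n i : ℕ} (h : i < n) (x : ℕ → Fin 2) :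
    appendSeq (List.replicate n 0 ++ [1]) x i = 0 := by
  have : i < n + 1 := by omega
  simp [appendSeq, this, h]

theorem appendSeq_block_apply_self (n : ℕ) (x : ℕ → Fin 2) :
    appendSeq (List.replicate n 0 ++ [1]) x n = 1 := by
  simp [appendSeq]

theorem appendSeq_block_injective {n k : ℕ} {x y : ℕ → Fin 2}
    (h : appendSeq (List.replicate n 0 ++ [1]) x = appendSeq (List.replicate k 0 ++ [1]) y) :
    n = k := by
  rcases lt_trichotomy n k with hnk | hnk | hnk
  · have := congrFun h n
    rw [appendSeq_block_apply_self, appendSeq_block_apply_of_lt hnk] at this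
    exact absurd this (by decide)
  · exact hnk
  · have := congrFun h k
    rw [appendSeq_block_apply_self, appendSeq_block_apply_of_lt hnk] at this
    exact absurd this (by decide)

theorem hCode_cons (n : ℕ) (s : List ℕ) :
    hCode (n :: s) = (List.replicate n 0 ++ [1]) ++ hCode s := rfl

theorem hCode_append_singleton (s : List ℕ) (l : ℕ) :
    hCode (s ++ [l]) = hCode s ++ (List.replicate l 0 ++ [1]) := by
  simp [hCode]

/-- If the infinite code of `s` begins with the code of `σ`, then `s` extends `σ`. -/
theorem prefix_of_hZero_eq {σ s : List ℕ} {y : ℕ → Fin 2}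
    (h : hZero s = appendSeq (hCode σ) y) : σ <+: s := by
  induction σ generalizing s with
  | nil => exact List.nil_prefix
  | cons n σ ih =>
    rw [hCode_cons, appendSeq_append] at h
    cases s with
    | nil =>
      have := congrFun h n
      rw [appendSeq_block_apply_self] at this
      exact absurd this (by simp [hZero, hCode, appendSeq])
    | cons k s =>
      rw [hZero, hCode_cons, appendSeq_append] at h
      obtain rfl := appendSeq_block_injective h
      exact List.cons_prefix_cons.2 ⟨rfl, ih (appendSeq_injective _ h)⟩

theorem hZero_append_singleton_apply (s : List ℕ) {l i : ℕ} (hi : i < l) :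
    hZero (s ++ [l]) i = hZero s i := by
  rw [hZero, hCode_append_singleton, appendSeq_append]
  exact appendSeq_congr_of_lt _ (fun t ht => appendSeq_block_apply_of_lt ht _) i hi

end Codes

/-! ### The witness function, and failure of strong Haar meagerness. -/

section Witness

variable {b : List ℕ → List (Fin 2)}

/-- The code cylinder is open and `cSet b σ` closed, so it suffices to check the generating points
of `kZero b`. There the code of `σ` being a prefix forces `s` to extend `σ`, and the sets `C_s`
decrease along extensions. -/
theorem fst_mem_cSet_of_mem_kZero (hb : IsBinarySystem b) {σ : List ℕ}
    {q : (ℕ → ℤ) × (ℕ → Fin 2)} (hq : q ∈ kZero b)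
    (hσ : q.2 ∈ PiNat.cylinder (hZero σ) (hCode σ).length) : q.1 ∈ cSet b σ := by
  have hcl : IsClosed {q : (ℕ → ℤ) × (ℕ → Fin 2) |
      q.2 ∈ PiNat.cylinder (hZero σ) (hCode σ).length → q.1 ∈ cSet b σ} :=
    isClosed_imp ((PiNat.isOpen_cylinder (fun _ => Fin 2) _ _).preimage continuous_snd)
      ((isCompact_segmentedCylinder (b σ) σ.length).isClosed.preimage continuous_fst)
  refine closure_minimal ?_ hcl hq hσ
  refine iUnion_subset fun s => ?_
  rintro ⟨x, _⟩ ⟨hx, rfl⟩ hs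
  have heq : hZero s = appendSeq (hCode σ) fun n => hZero s ((hCode σ).length + n) := by
    refine (appendSeq_eq_self fun n hn => ?_).symm
    refine (hs n hn).trans ?_
    simp [hZero, appendSeq, hn]
  obtain ⟨t, rfl⟩ := prefix_of_hZero_eq heq
  exact cSet_append_subset hb σ t hx

theorem isCompact_kZero (b : List ℕ → List (Fin 2)) : IsCompact (kZero b) := by
  refine ((isCompact_range continuous_binaryToInt).prod isCompact_univ).of_isClosed_subset
    isClosed_closure (closure_minimal ?_ ?_)
  · refine iUnion_subset fun s => ?_
    rintro ⟨_, _⟩ ⟨⟨x, -, rfl⟩, -⟩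
    exact ⟨mem_range_self _, mem_univ _⟩
  · exact ((isCompact_range continuous_binaryToInt).prod isCompact_univ).isClosed

theorem exists_binaryToInt_of_mem_kZero {q : (ℕ → ℤ) × (ℕ → Fin 2)} (hq : q ∈ kZero b) :
    ∃ x, binaryToInt x = q.1 := by
  have hcl := (isCompact_range continuous_binaryToInt).isClosed.preimage
    (continuous_fst (X := ℕ → ℤ) (Y := ℕ → Fin 2))
  refine closure_minimal ?_ hcl hq
  refine iUnion_subset fun s => ?_
  rintro ⟨_, _⟩ ⟨⟨x, -, rfl⟩, -⟩
  exact mem_range_self _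

/-- A translate of a closed set without its thin parts has a nowhere dense preimage in `K₀`. -/
theorem isNowhereDense_preimage_diff_thinPart (hb : IsBinarySystem b) {K : Set (ℕ → ℤ)}
    (hK : IsClosed K) (g : ℕ → ℤ) :
    IsNowhereDense {p : kZero b | p.1.1 - g ∈ K ∧ ∀ β m, p.1.1 - g ∉ thinPart K β m} := by
  set F := {p : kZero b | p.1.1 - g ∈ K ∧ ∀ β m, p.1.1 - g ∉ thinPart K β m} with hF
  have hFK : closure F ⊆ {p : kZero b | p.1.1 - g ∈ K} := by
    refine closure_minimal (fun p hp => hp.1) (hK.preimage ?_)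
    exact (continuous_fst.comp continuous_subtype_val).sub continuous_const
  refine eq_empty_of_forall_notMem fun p hp => ?_
  obtain ⟨W, hW, hWF⟩ := isOpen_induced_iff.1 (isOpen_interior (s := closure F))
  have hpW : p.1 ∈ W := by
    rw [← hWF] at hp
    exact hp
  obtain ⟨⟨_, _⟩, hqW, hq⟩ := mem_closure_iff.1 p.2 W hW hpW
  obtain ⟨s, ⟨u, hu, rfl⟩, rfl⟩ := mem_iUnion.1 hq
  obtain ⟨U₁, hU₁, U₂, hU₂, hUW⟩ := mem_nhds_prod_iff.1 (hW.mem_nhds hqW)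
  obtain ⟨n₁, hn₁⟩ := exists_prefix_subset hU₁
  obtain ⟨n₂, hn₂⟩ := exists_prefix_subset hU₂
  obtain ⟨l, hl, N, hN, hseg, hbl⟩ := hb.exists_large_extension s hu (max n₁ n₂)
  have hagree : ∀ w ∈ segmentedCylinder (b (s ++ [l])) s.length, w ∈ U₁ := by
    rintro _ ⟨v, -, rfl⟩
    refine hn₁ _ fun i hi => ?_
    simp only [binaryToInt]
    rw [hbl, appendSeq_append, appendSeq_congr_of_lt (n := N) (b s)
      (fun t ht => appendSeq_map_range u v ht) i (by omega)]
  have hsub : segmentedCylinder (b (s ++ [l])) s.length ⊆ cSet b s := by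
    rw [hbl]
    exact segmentedCylinder_append_subset _ hseg
  -- The level here is `s.length`, one below that of `cSet b (s ++ [l])`. The second coordinate
  -- stays `hZero s`, so these points are still in `kZero b`.
  have hinK : ∀ w ∈ segmentedCylinder (b (s ++ [l])) s.length, w - g ∈ K := by
    intro w hw
    have hwk : (w, hZero s) ∈ kZero b :=
      subset_closure (mem_iUnion.2 ⟨s, hsub hw, rfl⟩)
    have : (⟨_, hwk⟩ : kZero b) ∈ interior (closure F) := by
      rw [← hWF]
      exact hUW ⟨hagree w hw, hn₂ _ fun _ _ => rfl⟩
    exact hFK (interior_subset this)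
  have hthin : ∀ x ∈ cSet b (s ++ [l]), x - g ∈ thinPart K (b (s ++ [l])) s.length := by
    intro x hx
    refine ⟨x, by simpa [cSet, segmentedCylinder] using hx, fun w hw => ?_⟩
    have : x - g - x + w = w - g := by abel
    rw [this]
    exact hinK w hw
  obtain ⟨x, hx⟩ := segmentedCylinder_nonempty (b (s ++ [l])) (s ++ [l]).length
  have hxk : (x, hZero (s ++ [l])) ∈ kZero b :=
    subset_closure (mem_iUnion.2 ⟨s ++ [l], hx, rfl⟩)
  have hxF : (⟨_, hxk⟩ : kZero b) ∈ closure F := by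
    refine interior_subset (s := closure F) ?_
    rw [← hWF]
    refine hUW ⟨hagree x (segmentedCylinder_succ_subset _ _ (by simpa using hx)), ?_⟩
    exact hn₂ _ fun i hi => hZero_append_singleton_apply s (by omega)
  have hopen : IsOpen {p : kZero b |
      p.1.2 ∈ PiNat.cylinder (hZero (s ++ [l])) (hCode (s ++ [l])).length} :=
    (PiNat.isOpen_cylinder (fun _ => Fin 2) _ _).preimage
      (continuous_snd.comp continuous_subtype_val)
  -- Density of `F` yields a point of `F` whose code starts with that of `s ++ [l]`; its first
  -- coordinate lies in `C_{s ⌢ l}`, hence in the translated thin part that `F` avoids.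
  obtain ⟨q, hqo, hqF⟩ := mem_closure_iff.1 hxF _ hopen (PiNat.self_mem_cylinder _ _)
  exact hqF.2 _ _ (hthin _ (fst_mem_cSet_of_mem_kZero hb q.2 hqo))

/-- Two points of the translate that are binary differ by at most one in each coordinate, so they
have the same code. The preimage thus involves a single coded set. -/
theorem isMeagre_fZero_preimage_translate (hb : IsBinarySystem b) {V : ℕ → Set (ℕ → ℤ)}
    (hV : ∀ n, IsOpen (V n)) (g : ℕ → ℤ) :
    IsMeagre (fZero b ⁻¹' translateSet (shiftedUnion V) g) := by
  rcases (fZero b ⁻¹' translateSet (shiftedUnion V) g).eq_empty_or_nonempty with he | ⟨p₀, hp₀⟩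
  · rw [he]
    exact IsMeagre.empty
  obtain ⟨z₀, hz₀, hzp₀⟩ := hp₀
  have hK : IsClosed (codedSet V (decodeIndex z₀)) :=
    (isClosed_mem_codedSet hV).preimage
      (f := fun k => (k, decodeIndex z₀)) (by fun_prop)
  refine (isNowhereDense_preimage_diff_thinPart hb hK
    (codeShift (decodeIndex z₀) + g)).isMeagre.mono ?_
  rintro p ⟨z, hz, hzp⟩
  have hindex : decodeIndex z = decodeIndex z₀ := by
    funext n
    have h₀ := (hz₀.1 n).1
    have h := (hz.1 n).1
    simp only [decodeSeq, codeShift, Pi.sub_apply] at h h₀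
    refine interval_index_unique h h₀ ?_
    obtain ⟨x, hx⟩ := exists_binaryToInt_of_mem_kZero p.2
    obtain ⟨x₀, hx₀⟩ := exists_binaryToInt_of_mem_kZero p₀.2
    have e : z n + g n = binaryToInt x n := by
      rw [hx]
      exact congrFun hzp n
    have e₀ : z₀ n + g n = binaryToInt x₀ n := by
      rw [hx₀]
      exact congrFun hzp₀ n
    have := binaryToInt_nonneg x n
    have := binaryToInt_nonneg x₀ n
    have := binaryToInt_le_one x n
    have := binaryToInt_le_one x₀ n
    rw [abs_le]
    constructor <;> linarith
  have hdecode : p.1.1 - (codeShift (decodeIndex z₀) + g) = decodeSeq z := by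
    change fZero b p - _ = _
    rw [← hzp, decodeSeq, hindex]
    dsimp only
    abel
  rw [mem_ofPred_eq, hdecode, ← hindex]
  exact hz

theorem isWitnessFunction_fZero (hb : IsBinarySystem b) {V : ℕ → Set (ℕ → ℤ)}
    (hV : ∀ n, IsOpen (V n)) : IsWitnessFunction (fZero b) (shiftedUnion V) where
  nonempty := by
    obtain ⟨x, hx⟩ := segmentedCylinder_nonempty (b []) 0
    exact ⟨⟨(x, hZero []), subset_closure (mem_iUnion.2 ⟨[], hx, rfl⟩)⟩⟩
  compact := isCompact_iff_compactSpace.1 (isCompact_kZero b)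
  metrizable := inferInstance
  continuous := continuous_fst.comp continuous_subtype_val
  exists_borel := by
    borelize (ℕ → ℤ)
    exact ⟨_, (isGδ_shiftedUnion hV).measurableSet, Subset.rfl,
      isMeagre_fZero_preimage_translate hb hV⟩

theorem translateSet_mono {G : Type*} [AddCommGroup G] {A B : Set G} (h : A ⊆ B) (g : G) :
    translateSet A g ⊆ translateSet B g :=
  image_mono h

/-- A set having a translate comeager in each nonempty compact set is not strongly Haar meager. -/
theorem not_isStronglyHaarMeager_of_comeagerIn {G : Type*} [AddCommGroup G] [TopologicalSpace G]
    [IsTopologicalAddGroup G] [PolishSpace G] {A : Set G}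
    (hA : ∀ K : Set G, K.Nonempty → IsCompact K → ∃ g, ComeagerIn (translateSet A g) K) :
    ¬ IsStronglyHaarMeager A := by
  rintro ⟨B, -, hAB, C, hne, hC, hmeager⟩
  obtain ⟨g, hg⟩ := hA C hne hC
  have : CompactSpace C := isCompact_iff_compactSpace.1 hC
  have : Nonempty C := hne.to_subtype
  have h₁ : IsMeagre ((↑) ⁻¹' translateSet A g : Set C) :=
    (hmeager g).mono (preimage_mono (translateSet_mono hAB g))
  have h₂ := h₁.union hg
  rw [union_compl_self] at h₂
  exact not_isMeagre_of_isOpen isOpen_univ univ_nonempty h₂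

end Witness

theorem theorem1p5 :
    (∃ b : List ℕ → List (Fin 2), IsBinarySystem b) ∧
    (∀ b : List ℕ → List (Fin 2), IsBinarySystem b →
      ∃ R : Set (ℕ → ℤ),
        IsGδ R ∧
        IsHaarMeager R ∧
        ¬ IsStronglyHaarMeager R ∧
        IsWitnessFunction (fZero b) R ∧
        ∀ K : Set (ℕ → ℤ), K.Nonempty → IsCompact K →
          ∃ g : ℕ → ℤ, ComeagerIn (translateSet R g) K) ∧
    ¬ (∀ (G : Type) [AddCommGroup G] [TopologicalSpace G] [IsTopologicalAddGroup G]
        [PolishSpace G] (A : Set G), IsHaarMeager A → IsStronglyHaarMeager A) := by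
  obtain ⟨V, hV⟩ : ∃ V : ℕ → Set (ℕ → ℤ), TopologicalSpace.IsTopologicalBasis (range V) := by
    have hbasis := TopologicalSpace.isBasis_countableBasis (ℕ → ℤ)
    -- A nonempty countable basis is the range of a sequence.
    obtain ⟨U, hU, -⟩ := hbasis.exists_subset_of_mem_open (mem_univ 0) isOpen_univ
    obtain ⟨V, hV⟩ := (TopologicalSpace.countable_countableBasis (ℕ → ℤ)).exists_eq_range ⟨U, hU⟩
    exact ⟨V, hV ▸ hbasis⟩
  have hopen : ∀ n, IsOpen (V n) := fun n => hV.isOpen (mem_range_self n)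
  have hcomeager : ∀ K : Set (ℕ → ℤ), K.Nonempty → IsCompact K →
      ∃ g : ℕ → ℤ, ComeagerIn (translateSet (shiftedUnion V) g) K :=
    fun _ _ hK => exists_comeagerIn_translate hV hK
  have hnot := not_isStronglyHaarMeager_of_comeagerIn hcomeager
  have hmeager : ∀ b, IsBinarySystem b → IsHaarMeager (shiftedUnion V) :=
    fun b hb => ⟨kZero b, inferInstance, fZero b, isWitnessFunction_fZero hb hopen⟩
  refine ⟨exists_isBinarySystem, fun b hb => ⟨shiftedUnion V, isGδ_shiftedUnion hopen,
    hmeager b hb, hnot, isWitnessFunction_fZero hb hopen, hcomeager⟩, fun h => ?_⟩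
  obtain ⟨b, hb⟩ := exists_isBinarySystem
  exact hnot (h (ℕ → ℤ) _ (hmeager b hb))
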